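/- Call a sequence $\{a_k\}_{k\ge 0}$ of nonnegative real numbers log-convex if $a_m^2\le a_{m+1}a_{m-1}$ for all $m\ge 1$. The Bessel transformation preserves log-convexity: if $\{z_k\}_{k\ge 0}$ is a log-convex sequence of positive real numbers, then the sequence $\{w_n\}_{n\ge 0}$ defined by $$w_n=\sum_{k=0}^n \frac{(n+k)!}{(n-k)!\,k!}\,z_k$$ is also log-convex. -/

import Mathlib

open scoped Nat

/-- A sequence of nonnegative real numbers is log-convex if `z_m ^ 2 ≤ z_{m+1} z_{m-1}` for all
`m ≥ 1`. -/
def IsLogConvex (z : ℕ → ℝ) : Prop :=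
  (∀ k, 0 ≤ z k) ∧ ∀ m, 1 ≤ m → z m ^ 2 ≤ z (m + 1) * z (m - 1)

/-- The Bessel transformation, sending `z` to the sequence
`w_n = ∑_{k=0}^n (n+k)! / ((n-k)! k!) z_k`. Only terms with `k ≤ n` occur, so the natural number
subtraction is exact. -/
noncomputable def besselTransform (z : ℕ → ℝ) (n : ℕ) : ℝ :=
  ∑ k ∈ Finset.range (n + 1), ((n + k)! : ℝ) / (((n - k)! : ℝ) * (k ! : ℝ)) * z k

open Polynomial Finset

/-! Group the terms of `w (n+2) * w n - w (n+1) ^ 2` by `t = i + j`; each group is shown to be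
nonnegative. Within a group, the weights `z i * z j` decrease as `i * j` grows, while `besselTuran n
i j` changes sign at most once, from nonnegative to nonpositive
(`besselTuran_nonpos_of_mul_le_mul`). Replacing every weight by the one at the sign change can
therefore only lower the sum. This reduces the claim to `z = 1`, the coefficientwise log-convexity
of Bessel polynomials, which follows from their three-term recurrence. -/

/-- The coefficient `(n+k)! / ((n-k)! k!)` of the Bessel transformation, extended by zero to
`k > n`. -/
noncomputable def besselCoeff (n k : ℕ) : ℝ := ((n + k).descFactorial (2 * k) : ℝ) / (k ! : ℝ)

lemma besselCoeff_nonneg (n k : ℕ) : 0 ≤ besselCoeff n k := by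
  unfold besselCoeff; positivity

lemma besselCoeff_pos {n k : ℕ} (h : k ≤ n) : 0 < besselCoeff n k := by
  have : 0 < (n + k).descFactorial (2 * k) := Nat.descFactorial_pos.2 (by omega)
  unfold besselCoeff; positivity

lemma besselCoeff_eq_zero {n k : ℕ} (h : n < k) : besselCoeff n k = 0 := by
  simp [besselCoeff, Nat.descFactorial_eq_zero_iff_lt.2 (show n + k < 2 * k by omega)]

lemma besselCoeff_zero_right (n : ℕ) : besselCoeff n 0 = 1 := by simp [besselCoeff]

lemma besselCoeff_eq {n k : ℕ} (h : k ≤ n) :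
    besselCoeff n k = ((n + k)! : ℝ) / (((n - k)! : ℝ) * (k ! : ℝ)) := by
  have h1 := Nat.factorial_mul_descFactorial (show 2 * k ≤ n + k by omega)
  rw [show n + k - 2 * k = n - k by omega] at h1
  have h2 : (((n - k)! : ℕ) : ℝ) * ((n + k).descFactorial (2 * k) : ℝ) = ((n + k)! : ℝ) := by
    exact_mod_cast h1
  have h3 : (((n - k)! : ℕ) : ℝ) ≠ 0 := by positivity
  have h4 : ((k ! : ℕ) : ℝ) ≠ 0 := by positivity
  rw [besselCoeff, ← h2]
  field_simp

lemma cast_descFactorial_succ (n k : ℕ) :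
    (n.descFactorial (k + 1) : ℝ) = ((n : ℝ) - k) * n.descFactorial k := by
  rw [Nat.descFactorial_succ]
  rcases le_or_gt k n with h | h
  · push_cast [Nat.cast_sub h]; ring
  · simp [Nat.descFactorial_eq_zero_iff_lt.2 h]

/-- Peel off the last or the first factor of `(n + k + 1).descFactorial (2 * k + 1)`. -/
lemma besselCoeff_succ_left (n k : ℕ) :
    ((n : ℝ) + 1 - k) * besselCoeff (n + 1) k = (n + 1 + k) * besselCoeff n k := by
  have h1 := cast_descFactorial_succ (n + k + 1) (2 * k)
  rw [Nat.succ_descFactorial_succ] at h1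
  unfold besselCoeff
  rw [show n + 1 + k = n + k + 1 by ring, mul_div_assoc', mul_div_assoc']
  congr 1
  push_cast at h1 ⊢
  linear_combination -h1

lemma besselCoeff_recurrence (n k : ℕ) :
    besselCoeff (n + 2) (k + 1) =
      (4 * n + 6) * besselCoeff (n + 1) k + besselCoeff n (k + 1) := by
  unfold besselCoeff
  rw [show n + 2 + (k + 1) = n + k + 1 + 1 + 1 by ring, show 2 * (k + 1) = 2 * k + 1 + 1 by ring,
    show n + 1 + k = n + k + 1 by ring, show n + (k + 1) = n + k + 1 by ring,
    Nat.succ_descFactorial_succ, Nat.succ_descFactorial_succ]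
  simp only [Nat.cast_mul, cast_descFactorial_succ (n + k + 1), Nat.factorial_succ]
  have h4 : ((k ! : ℕ) : ℝ) ≠ 0 := by positivity
  push_cast
  field_simp
  ring

/-- The generating polynomial of the sequence `besselCoeff n k * z k`. -/
noncomputable def besselPoly (z : ℕ → ℝ) (n : ℕ) : ℝ[X] :=
  ∑ k ∈ range (n + 1), monomial k (besselCoeff n k * z k)

lemma coeff_besselPoly (z : ℕ → ℝ) (n k : ℕ) :
    (besselPoly z n).coeff k = besselCoeff n k * z k := by
  simp only [besselPoly, finsetSum_coeff, coeff_monomial, Finset.sum_ite_eq', mem_range]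
  split_ifs with h
  · rfl
  · rw [besselCoeff_eq_zero (by omega), zero_mul]

lemma eval_one_besselPoly (z : ℕ → ℝ) (n : ℕ) :
    (besselPoly z n).eval 1 = besselTransform z n := by
  simp only [besselPoly, besselTransform, eval_finsetSum, eval_monomial, one_pow, mul_one]
  refine Finset.sum_congr rfl fun k hk => ?_
  rw [besselCoeff_eq (by simpa [Nat.lt_succ_iff] using hk)]

lemma besselPoly_recurrence (n : ℕ) :
    besselPoly 1 (n + 2) = C (4 * n + 6 : ℝ) * X * besselPoly 1 (n + 1) + besselPoly 1 n := by
  ext k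
  rw [mul_assoc]
  cases k with
  | zero => simp [coeff_besselPoly, besselCoeff_zero_right]
  | succ k =>
    rw [coeff_add, coeff_C_mul, coeff_X_mul]
    simp [coeff_besselPoly, besselCoeff_recurrence]

/-- Bessel polynomials are coefficientwise log-convex. -/
lemma coeff_besselPoly_one_turan_nonneg (n : ℕ) :
    ∀ t, 0 ≤ (besselPoly 1 (n + 2) * besselPoly 1 n - besselPoly 1 (n + 1) ^ 2).coeff t := by
  have hB : ∀ n k, 0 ≤ (besselPoly 1 n).coeff k := fun n k => by
    simpa [coeff_besselPoly] using besselCoeff_nonneg n k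
  have hB2 : ∀ n k, 0 ≤ (besselPoly 1 n ^ 2).coeff k := fun n k => by
    rw [pow_two, coeff_mul]
    exact Finset.sum_nonneg fun x _ => mul_nonneg (hB _ _) (hB _ _)
  have hX2 : ∀ (a : ℝ) n k, 0 ≤ a → 0 ≤ (C a * (X ^ 2 * besselPoly 1 n ^ 2)).coeff k :=
    fun a n k ha => by
    rw [coeff_C_mul, coeff_X_pow_mul']
    split_ifs
    · exact mul_nonneg ha (hB2 _ _)
    · simp
  have h0 : besselPoly 1 0 = 1 := by simp [besselPoly, besselCoeff]
  have h1 : besselPoly 1 1 = 1 + C 2 * X := by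
    rw [besselPoly, sum_range_succ, sum_range_one]
    simp [besselCoeff, C_mul_X_eq_monomial]
  -- By the recurrence, the expression at `n + 2` is the one at `n` plus a nonnegative multiple of
  -- `X ^ 2 * besselPoly 1 (n + 2) ^ 2`. Hence steps of two and two base cases.
  induction n using Nat.twoStepInduction with
  | zero =>
    intro t
    have : besselPoly 1 (0 + 2) * besselPoly 1 0 - besselPoly 1 (0 + 1) ^ 2
        = C 2 * X ^ 1 + C 8 * X ^ 2 := by
      rw [besselPoly_recurrence, zero_add, h0, h1]
      simp only [Nat.cast_zero, mul_zero, zero_add, map_ofNat]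
      ring
    rw [this, coeff_add, coeff_C_mul_X_pow, coeff_C_mul_X_pow]
    positivity
  | one =>
    intro t
    have : besselPoly 1 (1 + 2) * besselPoly 1 1 - besselPoly 1 (1 + 1) ^ 2
        = C 2 * X ^ 1 + C 24 * (X ^ 2 * besselPoly 1 1 ^ 2) := by
      rw [besselPoly_recurrence 1, show 1 + 1 = 0 + 2 from rfl, besselPoly_recurrence 0, zero_add,
        h0, h1]
      simp only [Nat.cast_zero, Nat.cast_one, mul_zero, mul_one, zero_add, map_ofNat, map_add]
      ring
    rw [this, coeff_add, coeff_C_mul_X_pow]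
    have := hX2 24 1 t (by norm_num)
    positivity
  | more n ih _ =>
    intro t
    have : besselPoly 1 (n + 2 + 2) * besselPoly 1 (n + 2) - besselPoly 1 (n + 2 + 1) ^ 2
        = (besselPoly 1 (n + 2) * besselPoly 1 n - besselPoly 1 (n + 1) ^ 2)
          + C (4 * (4 * n + 10) : ℝ) * (X ^ 2 * besselPoly 1 (n + 2) ^ 2) := by
      rw [besselPoly_recurrence (n + 2), show n + 2 + 1 = n + 1 + 2 from rfl,
        besselPoly_recurrence (n + 1), show n + 1 + 1 = n + 2 from rfl, besselPoly_recurrence n]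
      simp only [map_add, map_mul, map_ofNat, map_natCast, Nat.cast_add, Nat.cast_ofNat,
        Nat.cast_one, map_one]
      ring
    rw [this, coeff_add]
    exact add_nonneg (ih t) (hX2 _ _ _ (by positivity))

/-- Twice the symmetrized coefficient of `z i * z j` in `w (n+2) * w n - w (n+1) ^ 2`, where `w` is
the Bessel transform of `z`. -/
noncomputable def besselTuran (n i j : ℕ) : ℝ :=
  besselCoeff (n + 2) i * besselCoeff n j + besselCoeff n i * besselCoeff (n + 2) j
    - 2 * (besselCoeff (n + 1) i * besselCoeff (n + 1) j)

lemma two_mul_coeff_besselPoly_turan (z : ℕ → ℝ) (n t : ℕ) :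
    2 * (besselPoly z (n + 2) * besselPoly z n - besselPoly z (n + 1) ^ 2).coeff t =
      ∑ x ∈ antidiagonal t, besselTuran n x.1 x.2 * (z x.1 * z x.2) := by
  have h : besselPoly z (n + 2) * besselPoly z n - besselPoly z (n + 1) ^ 2
      + (besselPoly z n * besselPoly z (n + 2) - besselPoly z (n + 1) * besselPoly z (n + 1)) =
      C 2 * (besselPoly z (n + 2) * besselPoly z n - besselPoly z (n + 1) ^ 2) := by
    rw [map_ofNat]; ring
  rw [← coeff_C_mul, ← h, pow_two]
  simp only [coeff_add, coeff_sub, coeff_mul, coeff_besselPoly, ← Finset.sum_sub_distrib,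
    ← Finset.sum_add_distrib]
  refine Finset.sum_congr rfl fun x _ => ?_
  rw [besselTuran]
  ring

lemma sum_besselTuran_nonneg (n t : ℕ) :
    0 ≤ ∑ x ∈ antidiagonal t, besselTuran n x.1 x.2 := by
  have h := two_mul_coeff_besselPoly_turan 1 n t
  simp only [Pi.one_apply, mul_one] at h
  rw [← h]
  exact mul_nonneg zero_le_two (coeff_besselPoly_one_turan_nonneg n t)

/-- Otherwise the subtracted product vanishes. -/
lemma le_of_besselTuran_neg {n i j : ℕ} (h : besselTuran n i j < 0) : i ≤ n + 1 ∧ j ≤ n + 1 := by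
  by_contra hc
  refine absurd h (not_lt.2 ?_)
  have h1 := mul_nonneg (besselCoeff_nonneg (n + 2) i) (besselCoeff_nonneg n j)
  have h2 := mul_nonneg (besselCoeff_nonneg n i) (besselCoeff_nonneg (n + 2) j)
  have h3 : besselCoeff (n + 1) i * besselCoeff (n + 1) j = 0 := by
    rcases lt_or_ge (n + 1) i with hi | hi
    · rw [besselCoeff_eq_zero hi, zero_mul]
    · rw [besselCoeff_eq_zero (show n + 1 < j by omega), mul_zero]
  rw [besselTuran, h3]
  linarith

/-- For `i, j ≤ n + 1`, the sign of `besselTuran n i j` is that of an expression which is decreasing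
in the product `i * j` when `i + j` is fixed. -/
lemma exists_pos_mul_besselTuran {n i j : ℕ} (hi : i ≤ n + 1) (hj : j ≤ n + 1) :
    ∃ a > 0, ∃ b > 0, a * besselTuran n i j = b * (((n : ℝ) + 1) * (n + 2) * ((i : ℝ) + j)
      * (2 * ((i : ℝ) + j) - 1) - (i : ℝ) * j * (8 * (n + 1) * (n + 2) + 2 - (i + j))) := by
  have hi' : (i : ℝ) ≤ n + 1 := by exact_mod_cast hi
  have hj' : (j : ℝ) ≤ n + 1 := by exact_mod_cast hj
  have a1 := besselCoeff_succ_left (n + 1) i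
  have a2 := besselCoeff_succ_left n i
  have b1 := besselCoeff_succ_left (n + 1) j
  have b2 := besselCoeff_succ_left n j
  -- The first witness clears the denominators of the ratios of `besselCoeff (n + 2)` and
  -- `besselCoeff n` to `besselCoeff (n + 1)`, at `i` and at `j`.
  refine ⟨((n : ℝ) + 2 - i) * (n + 1 + i) * ((n + 2 - j) * (n + 1 + j)), ?_,
    2 * (besselCoeff (n + 1) i * besselCoeff (n + 1) j), ?_, ?_⟩
  · have h1 : 0 < (n : ℝ) + 2 - i := by linarith
    have h2 : 0 < (n : ℝ) + 2 - j := by linarith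
    positivity
  · have := besselCoeff_pos hi
    have := besselCoeff_pos hj
    positivity
  · rw [besselTuran]
    push_cast at a1 a2 b1 b2
    rw [show n + 1 + 1 = n + 2 from rfl] at a1 b1
    generalize besselCoeff (n + 2) i = p2 at *
    generalize besselCoeff (n + 1) i = p1 at *
    generalize besselCoeff n i = p0 at *
    generalize besselCoeff (n + 2) j = q2 at *
    generalize besselCoeff (n + 1) j = q1 at *
    generalize besselCoeff n j = q0 at *
    have e1 : ((n : ℝ) + 2 - i) * p2 = (n + 2 + i) * p1 := by linear_combination a1
    have e2 : ((n : ℝ) + 2 - j) * q2 = (n + 2 + j) * q1 := by linear_combination b1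
    calc _ = (((n : ℝ) + 2 - i) * p2) * ((n + 1 + j) * q0) * ((n + 1 + i) * (n + 2 - j))
          + (((n : ℝ) + 2 - j) * q2) * ((n + 1 + i) * p0) * ((n + 1 + j) * (n + 2 - i))
          - 2 * (((n : ℝ) + 2 - i) * (n + 1 + i) * ((n + 2 - j) * (n + 1 + j))) * (p1 * q1) := by
            ring
      _ = _ := by rw [e1, e2, ← a2, ← b2]; ring

/-- At fixed sum, a larger product means a more balanced pair. -/
lemma min_le_min_of_mul_le_mul {i j k l : ℕ} (hs : i + j = k + l) (hp : i * j ≤ k * l) :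
    min i j ≤ min k l := by
  wlog hij : i ≤ j generalizing i j
  · rw [min_comm]
    exact this (by omega) (by rwa [mul_comm]) (by omega)
  wlog hkl : k ≤ l generalizing k l
  · rw [min_comm k]
    exact this (by omega) (by rwa [mul_comm l]) (by omega)
  rw [min_eq_left hij, min_eq_left hkl]
  by_contra! hc
  obtain ⟨a, rfl⟩ := Nat.exists_eq_add_of_lt hc
  obtain ⟨b, rfl⟩ := Nat.exists_eq_add_of_le (show k + a + 1 ≤ j from hij)
  obtain rfl : l = k + a + 1 + a + 1 + b := by omega
  nlinarith

lemma besselTuran_nonpos_of_mul_le_mul {n i j k l : ℕ} (hs : i + j = k + l) (hp : i * j ≤ k * l)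
    (h : besselTuran n i j < 0) : besselTuran n k l ≤ 0 := by
  obtain ⟨hi, hj⟩ := le_of_besselTuran_neg h
  have hm := min_le_min_of_mul_le_mul hs hp
  have hk : k ≤ n + 1 := by omega
  have hl : l ≤ n + 1 := by omega
  obtain ⟨a, ha, b, hb, hab⟩ := exists_pos_mul_besselTuran hi hj
  obtain ⟨c, hc, d, hd, hcd⟩ := exists_pos_mul_besselTuran hk hl
  have hs' : (i : ℝ) + j = k + l := by exact_mod_cast hs
  have hp' : (i : ℝ) * j ≤ k * l := by exact_mod_cast hp
  have hk' : (k : ℝ) ≤ n + 1 := by exact_mod_cast hk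
  have hl' : (l : ℝ) ≤ n + 1 := by exact_mod_cast hl
  have h1 := neg_of_mul_neg_right (hab ▸ mul_neg_of_pos_of_neg ha h) hb.le
  -- The factor of `k * l` is nonnegative because `k + l ≤ 2 * n + 2`.
  have h2 : 0 ≤ 8 * ((n : ℝ) + 1) * (n + 2) + 2 - (k + l) := by nlinarith
  rw [hs'] at h1
  have h3 := mul_le_mul_of_nonneg_right hp' h2
  refine nonpos_of_mul_nonpos_right ?_ hc
  rw [hcd]
  exact mul_nonpos_of_nonneg_of_nonpos hd.le (by linarith)

/-- The ratios `z (k + 1) / z k` are nondecreasing. -/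
lemma IsLogConvex.mul_succ_le {z : ℕ → ℝ} (hpos : ∀ k, 0 < z k) (hz : IsLogConvex z) {a b : ℕ}
    (h : a ≤ b) : z (a + 1) * z b ≤ z a * z (b + 1) := by
  induction b, h using Nat.le_induction with
  | base => rw [mul_comm]
  | succ b _ ih =>
    have h1 := hz.2 (b + 1) (by omega)
    rw [Nat.add_sub_cancel] at h1
    refine le_of_mul_le_mul_right ?_ (hpos b)
    nlinarith [mul_le_mul_of_nonneg_right ih (hpos (b + 1)).le,
      mul_le_mul_of_nonneg_left h1 (hpos a).le]

lemma IsLogConvex.mul_add_le {z : ℕ → ℝ} (hpos : ∀ k, 0 < z k) (hz : IsLogConvex z) {a b : ℕ}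
    (h : a ≤ b) (d : ℕ) : z (a + d) * z b ≤ z a * z (b + d) := by
  induction d with
  | zero => simp
  | succ d ih =>
    have h1 := hz.mul_succ_le hpos (Nat.add_le_add_right h d)
    have h2 := mul_le_mul h1 ih (mul_pos (hpos _) (hpos _)).le (mul_pos (hpos _) (hpos _)).le
    refine le_of_mul_le_mul_right ?_ (mul_pos (hpos (a + d)) (hpos (b + d)))
    rw [← add_assoc, ← add_assoc]
    linarith

lemma IsLogConvex.mul_le_mul_of_mul_le_mul {z : ℕ → ℝ} (hpos : ∀ k, 0 < z k)
    (hz : IsLogConvex z) {i j k l : ℕ} (hs : i + j = k + l) (hp : i * j ≤ k * l) :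
    z k * z l ≤ z i * z j := by
  wlog hij : i ≤ j generalizing i j
  · rw [mul_comm (z i)]
    exact this (by omega) (by rwa [mul_comm]) (by omega)
  wlog hkl : k ≤ l generalizing k l
  · rw [mul_comm (z k)]
    exact this (by omega) (by rwa [mul_comm l]) (by omega)
  have hm := min_le_min_of_mul_le_mul hs hp
  obtain ⟨d, rfl⟩ := Nat.exists_eq_add_of_le (show i ≤ k by omega)
  obtain rfl : j = l + d := by omega
  exact hz.mul_add_le hpos (by omega) d

lemma sum_besselTuran_mul_nonneg {z : ℕ → ℝ} (hpos : ∀ k, 0 < z k) (hz : IsLogConvex z)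
    (n t : ℕ) : 0 ≤ ∑ x ∈ antidiagonal t, besselTuran n x.1 x.2 * (z x.1 * z x.2) := by
  rcases ((antidiagonal t).filter fun x => besselTuran n x.1 x.2 < 0).eq_empty_or_nonempty
    with h | h
  · rw [Finset.filter_eq_empty_iff] at h
    exact Finset.sum_nonneg fun x hx =>
      mul_nonneg (not_lt.1 (h hx)) (mul_pos (hpos _) (hpos _)).le
  -- `y` marks the sign change: the negative coefficient with the smallest product. Its weight
  -- serves as the common weight.
  · obtain ⟨y, hy, hmin⟩ := Finset.exists_min_image _ (fun x : ℕ × ℕ => x.1 * x.2) h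
    simp only [Finset.mem_filter, HasAntidiagonal.mem_antidiagonal, and_imp] at hy hmin
    calc 0 ≤ (∑ x ∈ antidiagonal t, besselTuran n x.1 x.2) * (z y.1 * z y.2) :=
          mul_nonneg (sum_besselTuran_nonneg n t) (mul_pos (hpos _) (hpos _)).le
      _ ≤ _ := by
          rw [Finset.sum_mul]
          refine Finset.sum_le_sum fun x hx => ?_
          rw [HasAntidiagonal.mem_antidiagonal] at hx
          rcases lt_or_ge (besselTuran n x.1 x.2) 0 with hneg | hnonneg
          · exact mul_le_mul_of_nonpos_left (hz.mul_le_mul_of_mul_le_mul hpos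
              (hy.1.trans hx.symm) (hmin x hx hneg)) hneg.le
          · rcases le_total (x.1 * x.2) (y.1 * y.2) with hp | hp
            · exact mul_le_mul_of_nonneg_left (hz.mul_le_mul_of_mul_le_mul hpos
                (hx.trans hy.1.symm) hp) hnonneg
            -- Past `y` coefficients are nonpositive, so a nonnegative one is zero.
            · rw [le_antisymm (besselTuran_nonpos_of_mul_le_mul (hy.1.trans hx.symm) hp hy.2)
                hnonneg, zero_mul, zero_mul]

theorem theorem4p3 (z : ℕ → ℝ) (hpos : ∀ k, 0 < z k) (hz : IsLogConvex z) :
    IsLogConvex (besselTransform z) := by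
  refine ⟨fun n => Finset.sum_nonneg fun k _ => mul_nonneg (by positivity) (hpos k).le, ?_⟩
  intro m hm
  obtain ⟨n, rfl⟩ := Nat.exists_eq_add_of_le' hm
  rw [Nat.add_sub_cancel, ← sub_nonneg]
  have h : 0 ≤ (besselPoly z (n + 2) * besselPoly z n - besselPoly z (n + 1) ^ 2).eval 1 := by
    rw [eval_eq_sum]
    refine Finset.sum_nonneg fun t _ => mul_nonneg ?_ (by simp)
    have h1 := sum_besselTuran_mul_nonneg hpos hz n t
    rw [← two_mul_coeff_besselPoly_turan] at h1
    linarith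
  simpa only [eval_sub, eval_mul, eval_pow, eval_one_besselPoly] using h
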